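/- **Setting.** Let $F\subset\mathbb R^d$ be bounded with Minkowski dimension $s$, and let $F_\varepsilon=\{x: d(x,F)\le\varepsilon\}$. Assume: (A1) For almost all $\varepsilon>0$ the curvature measures $C_0(F_\varepsilon,\cdot),\dots,C_d(F_\varepsilon,\cdot)$ are defined. (For a set $K$ of positive reach they are given by Federer's local Steiner formula. They extend additively, by inclusion–exclusion, to finite unions of compact sets all of whose nonempty intersections have positive reach. If $\varepsilon$ is a regular value of the distance function of $F$, then $C_k(F_\varepsilon,\cdot)=(-1)^{d-k-1}C_k(\overline{\mathbb R^d\setminus F_\varepsilon},\cdot)$ for $k<d$. $C_d$ is the volume.) Put $C_k(F_\varepsilon):=C_k(F_\varepsilon,\mathbb R^d)$. (A2) For each $k=0,\dots,d$, the function $\varepsilon\mapsto C_k(F_\varepsilon)$ (defined for almost all $\varepsilon>0$) is either strictly positive or strictly negative, almost everywhere. (A3) For each $k=0,\dots,d$, the fractal curvature $\mathcal C_k(F):=\operatorname{ess\,lim}_{\varepsilon\searrow0}\varepsilon^{s-k}C_k(F_\varepsilon)$ exists in $\mathbb R$ and is nonzero. Put $\beta_k:=\log|\mathcal C_k(F)|$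 and $\beta:=(\beta_0,\dots,\beta_d,s)^\top\in\mathbb R^{d+2}$. Let $\varepsilon_1>\varepsilon_2>\dots>0$ be radii, $x_j:=-\log\varepsilon_j$, $\bar x_n:=\frac1n\sum_{i\le n}x_i$ and $\widetilde S_n^2:=\frac1n\sum_{i\le n}(x_i-\bar x_n)^2$. Suppose that the observations satisfy $$y_{kj}=\beta_k+s\,x_j+\delta_{kj},\qquad k=0,\dots,d,\ j\in\mathbb N,$$ where the errors $\delta_{kj}$ ($k=0,\dots,d$, $j\in\mathbb N$) are independent and identically distributed real random variables with mean $0$ and finite variance $\sigma^2>0$; in particular, the covariance matrix of the errors belonging to the first $n$ radii is $Q_n=\sigma^2I$. Let $X_n$ be the $n(d+1)\times(d+2)$ regression matrix of this linear model for the first $n$ radii (the row of the pair $(j,k)$ has the entry $1$ in the column of $\beta_k$, the entry $x_j$ in the column of $s$, and $0$ elsewhere), let $y_n$ be the vector of the corresponding observations, and let $\hat\beta^{(n)}:=(X_n^\top X_n)^{-1}X_n^\top y_n$ be the least-squares estimator of $\beta$ ($n\ge2$). **Theorem.** Suppose that there are constants $\gamma,\mu\ge0$ with $\max\{\mu,2\mu-\gamma\}<1$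 such that, as $n\to\infty$, $$\widetilde S_n^2=\Theta(n^\gamma)\quad\text{and}\quad x_n=O(n^{\mu/2}).$$ Then, for each $t\in\mathbb R^{d+2}\setminus\{0\}$, $$\frac{t^\top(\hat\beta^{(n)}-\beta)}{\sigma\sqrt{t^\top(X_n^\top X_n)^{-1}t}}\ \xrightarrow{\ d\ }\ \mathcal N(0,1),\qquad n\to\infty.$$ -/

import Mathlib

open MeasureTheory ProbabilityTheory Filter Topology Asymptotics
open scoped Matrix

/-! ### Curvature measures -/

/-- `κ_j`, the volume of the unit ball of `ℝ^j`. -/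
noncomputable def unitBallVolume (j : ℕ) : ℝ :=
  volume.real (Metric.ball (0 : EuclideanSpace ℝ (Fin j)) 1)

/-- The points of `K` that are nearest to `x`. -/
def nearestPoints {d : ℕ} (K : Set (EuclideanSpace ℝ (Fin d)))
    (x : EuclideanSpace ℝ (Fin d)) : Set (EuclideanSpace ℝ (Fin d)) :=
  {y | y ∈ K ∧ dist x y = Metric.infDist x K}

/-- `K` has positive reach, and `C k` for `k < d` are its curvature measures `C_k(K, ·)`.
There is `r > 0` such that all points at distance less than `r` from `K` have a unique nearest point
in `K`, and, for `0 < ρ < r`, the local Steiner formula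
`vol ((K_ρ \ K) ∩ p_K⁻¹ A) = ∑_{k < d} ρ^(d-k) κ_(d-k) C_k(K, A)` holds for all Borel sets `A`.
The part of `p_K⁻¹ A` inside `K`, which is `K ∩ A` and corresponds to the summand
`C_d(K, A) = vol (K ∩ A)`, is removed on both sides, so that the definition also makes sense for
unbounded sets with bounded boundary. -/
def IsSteinerCurvature {d : ℕ} (K : Set (EuclideanSpace ℝ (Fin d)))
    (C : ℕ → SignedMeasure (EuclideanSpace ℝ (Fin d))) : Prop :=
  IsClosed K ∧ ∃ r : ℝ, 0 < r ∧
    (∀ x, Metric.infDist x K < r → ∃! y, y ∈ nearestPoints K x) ∧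
    ∀ ρ : ℝ, 0 < ρ → ρ < r → ∀ A : Set (EuclideanSpace ℝ (Fin d)), MeasurableSet A →
      volume.real ((Metric.cthickening ρ K \ K) ∩ {x | (nearestPoints K x ∩ A).Nonempty}) =
        ∑ k ∈ Finset.range d, ρ ^ (d - k) * unitBallVolume (d - k) * C k A

/-- Additive extension by the inclusion-exclusion formula: `K` is a finite union of compact sets
such that each nonempty intersection of some of them has positive reach (for instance, a finite
union of compact convex sets), and `C k` for `k < d` are its curvature measures. -/
def IsAdditiveCurvature {d : ℕ} (K : Set (EuclideanSpace ℝ (Fin d)))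
    (C : ℕ → SignedMeasure (EuclideanSpace ℝ (Fin d))) : Prop :=
  ∃ (m : ℕ) (L : Fin m → Set (EuclideanSpace ℝ (Fin d)))
    (D : Finset (Fin m) → ℕ → SignedMeasure (EuclideanSpace ℝ (Fin d))),
    (∀ i, IsCompact (L i)) ∧ K = ⋃ i, L i ∧
    (∀ I : Finset (Fin m), I.Nonempty →
      ((⋂ i ∈ I, L i) = ∅ ∧ D I = 0) ∨ IsSteinerCurvature (⋂ i ∈ I, L i) (D I)) ∧
    ∀ k < d, C k = ∑ I ∈ (Finset.univ : Finset (Finset (Fin m))) with I.Nonempty,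
      (-1 : ℝ) ^ (I.card - 1) • D I k

/-- `ε > 0` is a regular value of the distance function of `F`: no point `x` at distance `ε` from
`F` is critical, i.e. lies in the convex hull of its nearest points in the closure of `F`. -/
def IsRegularRadius {d : ℕ} (F : Set (EuclideanSpace ℝ (Fin d))) (ε : ℝ) : Prop :=
  0 < ε ∧ ∀ x, Metric.infDist x F = ε → x ∉ convexHull ℝ (nearestPoints (closure F) x)

/-- Reflection principle: `ε` is a regular radius of `F`, the closed complement of the parallel set
`F_ε` has positive reach, and `C k` for `k < d` is `(-1)^(d-k-1)` times the `k`-th curvature measure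
of this closed complement. -/
def IsReflectedCurvature {d : ℕ} (F : Set (EuclideanSpace ℝ (Fin d))) (ε : ℝ)
    (C : ℕ → SignedMeasure (EuclideanSpace ℝ (Fin d))) : Prop :=
  IsRegularRadius F ε ∧
    ∃ D : ℕ → SignedMeasure (EuclideanSpace ℝ (Fin d)),
      IsSteinerCurvature (closure (Metric.cthickening ε F)ᶜ) D ∧
      ∀ k < d, C k = (-1 : ℝ) ^ (d - k - 1) • D k

/-- `C k` for `k < d` are the curvature measures `C_k(F_ε, ·)` of the parallel set `F_ε`. -/
def IsParallelCurvature {d : ℕ} (F : Set (EuclideanSpace ℝ (Fin d))) (ε : ℝ)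
    (C : ℕ → SignedMeasure (EuclideanSpace ℝ (Fin d))) : Prop :=
  IsAdditiveCurvature (Metric.cthickening ε F) C ∨ IsReflectedCurvature F ε C

open Classical in
/-- The total curvature `C_k(F_ε) = C_k(F_ε, ℝ^d)`. For `k = d` it is the volume of `F_ε`, and for
`k < d` it is the total mass of the `k`-th curvature measure (with value `0` if the curvature
measures are not defined). -/
noncomputable def totalCurvature {d : ℕ} (F : Set (EuclideanSpace ℝ (Fin d))) (ε : ℝ)
    (k : Fin (d + 1)) : ℝ :=
  if (k : ℕ) = d then volume.real (Metric.cthickening ε F)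
  else if h : ∃ C, IsParallelCurvature F ε C then h.choose k Set.univ
  else 0

/-! ### Assumptions on the fractal set -/

/-- The curvature measures of `F_ε` are defined for almost all `ε > 0`. -/
def CurvaturesDefined {d : ℕ} (F : Set (EuclideanSpace ℝ (Fin d))) : Prop :=
  ∀ᵐ ε ∂(volume.restrict (Set.Ioi (0 : ℝ))), ∃ C, IsParallelCurvature F ε C

/-- Each total curvature `C_k(F_ε)`, as a function of `ε > 0` (which is defined almost everywhere),
is strictly positive or strictly negative. -/
def CurvaturesOfConstantSign {d : ℕ} (F : Set (EuclideanSpace ℝ (Fin d))) : Prop :=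
  ∀ k : Fin (d + 1),
    (∀ᵐ ε ∂(volume.restrict (Set.Ioi (0 : ℝ))), 0 < totalCurvature F ε k) ∨
    (∀ᵐ ε ∂(volume.restrict (Set.Ioi (0 : ℝ))), totalCurvature F ε k < 0)

/-- `F` has Minkowski dimension `s`. -/
def HasMinkowskiDimension {d : ℕ} (F : Set (EuclideanSpace ℝ (Fin d))) (s : ℝ) : Prop :=
  Tendsto (fun ε : ℝ => (d : ℝ) - Real.log (volume.real (Metric.cthickening ε F)) / Real.log ε)
    (𝓝[>] 0) (𝓝 s)

/-- The `k`-th fractal curvature of a set `F` of dimension `s` exists and equals `c`: it is the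
essential limit of `ε^(s-k) C_k(F_ε)` as `ε ↘ 0`. -/
def HasFractalCurvature {d : ℕ} (F : Set (EuclideanSpace ℝ (Fin d))) (s : ℝ) (k : Fin (d + 1))
    (c : ℝ) : Prop :=
  Tendsto (fun ε : ℝ => ε ^ (s - (k : ℕ)) * totalCurvature F ε k) (𝓝[>] 0 ⊓ ae volume) (𝓝 c)

/-! ### Regression

The radii are `ε 0 > ε 1 > …`, so that the first `n` radii are `ε j` with `j < n`. -/

/-- `x_j = - log ε_j`. -/
noncomputable def logRadius (ε : ℕ → ℝ) (j : ℕ) : ℝ := -Real.log (ε j)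

/-- The mean of `x` over the first `n` radii. -/
noncomputable def meanLogRadius (ε : ℕ → ℝ) (n : ℕ) : ℝ :=
  (∑ j ∈ Finset.range n, logRadius ε j) / n

/-- The empirical variance `S̃_n²` of `x` over the first `n` radii. -/
noncomputable def varLogRadius (ε : ℕ → ℝ) (n : ℕ) : ℝ :=
  (∑ j ∈ Finset.range n, (logRadius ε j - meanLogRadius ε n) ^ 2) / n

/-- The regression matrix `X_n`. Its rows are indexed by the pairs `(j, k)` of a radius and a
curvature index, and its columns by the `d + 2` parameters: `Sum.inl k` stands for `β_k`, and
`Sum.inr ()` for the dimension `s`. -/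
noncomputable def regressionMatrix (d : ℕ) (ε : ℕ → ℝ) (n : ℕ) :
    Matrix (Fin n × Fin (d + 1)) (Fin (d + 1) ⊕ Unit) ℝ :=
  Matrix.of fun p q => Sum.elim (fun k => if p.2 = k then 1 else 0) (fun _ => logRadius ε p.1) q

/-- The least squares estimator `(XᵀX)⁻¹ Xᵀ y` based on the first `n` radii. -/
noncomputable def leastSquares {d : ℕ} (ε : ℕ → ℝ) (n : ℕ) (y : ℕ → Fin (d + 1) → ℝ) :
    Fin (d + 1) ⊕ Unit → ℝ :=
  ((regressionMatrix d ε n)ᵀ * regressionMatrix d ε n)⁻¹ *ᵥ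
    ((regressionMatrix d ε n)ᵀ *ᵥ fun p => y p.1 p.2)

/-- The covariance matrix `Q_n` of the (centered) errors belonging to the first `n` radii. -/
noncomputable def errorCovariance {d : ℕ} {Ω : Type*} [MeasurableSpace Ω] (P : Measure Ω)
    (δ : ℕ → Fin (d + 1) → Ω → ℝ) (n : ℕ) :
    Matrix (Fin n × Fin (d + 1)) (Fin n × Fin (d + 1)) ℝ :=
  Matrix.of fun p q => ∫ ω, δ p.1 p.2 ω * δ q.1 q.2 ω ∂P

/-! ### A central limit theorem for weighted sums -/

/-! The estimation error is linear in the errors: with `G = XᵀX` and `a = X G⁻¹ t`, one has `t·(β̂ -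
β) = ∑ a_p δ_p` and `tᵀG⁻¹t = ∑ a_p²` (`dotProduct_leastSquares_sub`, `dotProduct_gram_inv_mulVec`).
The standardized error is therefore a weighted sum of i.i.d. standardized variables whose weights
`a_p / ‖a‖` have square sum 1, and such sums are asymptotically normal once the largest weight tends
to 0 (`tendstoInDistribution_weighted_sum`, by characteristic functions).

The weights are small because `a` lies in the range of `X`. Centering the regressors at their mean
diagonalizes `‖Xu‖²`, which bounds each squared entry of `Xu` by `2/n + 2R/(n S̃_n²)` times `‖Xu‖²`,
where `R` bounds `(x_j - x̄_n)²`. Here `R = O(n^μ)` with `μ < 1`, and `S̃_n²` is eventually bounded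
below by a positive constant, so the factor tends to 0. -/

theorem norm_prod_sub_prod_le_sum {ι : Type*} (s : Finset ι) (z w : ι → ℂ)
    (hz : ∀ i ∈ s, ‖z i‖ ≤ 1) (hw : ∀ i ∈ s, ‖w i‖ ≤ 1) :
    ‖∏ i ∈ s, z i - ∏ i ∈ s, w i‖ ≤ ∑ i ∈ s, ‖z i - w i‖ := by
  classical
  induction s using Finset.induction_on with
  | empty => simp
  | insert i s hi ih =>
    rw [Finset.prod_insert hi, Finset.prod_insert hi, Finset.sum_insert hi]
    have ih' := ih (fun j hj => hz j (Finset.mem_insert_of_mem hj))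
      (fun j hj => hw j (Finset.mem_insert_of_mem hj))
    have h1 : ‖∏ j ∈ s, z j‖ ≤ 1 := by
      rw [norm_prod]
      exact Finset.prod_le_one (fun _ _ => norm_nonneg _)
        (fun j hj => hz j (Finset.mem_insert_of_mem hj))
    have h2 := hw i (Finset.mem_insert_self i s)
    -- Exchange one factor at a time; the remaining factors lie in the unit disc.
    calc ‖z i * ∏ j ∈ s, z j - w i * ∏ j ∈ s, w j‖
        = ‖(z i - w i) * ∏ j ∈ s, z j + w i * (∏ j ∈ s, z j - ∏ j ∈ s, w j)‖ := by
          congr 1; ring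
      _ ≤ ‖z i - w i‖ * ‖∏ j ∈ s, z j‖ + ‖w i‖ * ‖∏ j ∈ s, z j - ∏ j ∈ s, w j‖ := by
          rw [← norm_mul, ← norm_mul]; exact norm_add_le _ _
      _ ≤ ‖z i - w i‖ * 1 + 1 * ∑ j ∈ s, ‖z j - w j‖ := by gcongr
      _ = _ := by ring

/-- Mean 0 and variance 1 give both characteristic functions the same second-order Taylor polynomial
at 0. -/
theorem charFun_sub_charFun_gaussianReal_isLittleO {Ω : Type*} [MeasurableSpace Ω]
    {P : Measure Ω} [IsProbabilityMeasure P] {X : Ω → ℝ} (hX : AEMeasurable X P)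
    (h0 : P[X] = 0) (h1 : P[X ^ 2] = 1) :
    (fun t => charFun (P.map X) t - charFun (gaussianReal 0 1) t) =o[𝓝 0]
      fun t : ℝ => (t : ℂ) ^ 2 := by
  have hG := taylor_charFun_two (P := gaussianReal 0 1) (X := id) aemeasurable_id
    (by simp) (by
      have h := variance_eq_integral (μ := gaussianReal 0 1) (X := id) aemeasurable_id
      simpa [variance_id_gaussianReal] using h.symm)
  rw [Measure.map_id] at hG
  have h := ((taylor_charFun_two hX h0 h1).sub hG)
  refine IsLittleO.of_norm_right ((h.congr_left fun t => by ring).norm_right.congr_right ?_)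
  intro t; simp

/-- Central limit theorem for weighted sums: the weights have square sum `1` and are uniformly
small. -/
theorem tendstoInDistribution_weighted_sum {Ω ι : Type*} [MeasurableSpace Ω] {P : Measure Ω}
    [IsProbabilityMeasure P] {X : ι → Ω → ℝ} (hindep : iIndepFun X P) (i₀ : ι)
    (hident : ∀ i, IdentDistrib (X i) (X i₀) P P) (h0 : P[X i₀] = 0) (h1 : P[X i₀ ^ 2] = 1)
    {κ : ℕ → Type*} [∀ n, Fintype (κ n)] {e : ∀ n, κ n → ι}
    (he : ∀ n, Function.Injective (e n)) (b : ∀ n, κ n → ℝ)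
    (hb : ∀ᶠ n in atTop, ∑ p, b n p ^ 2 = 1) {B : ℕ → ℝ} (hB : Tendsto B atTop (𝓝 0))
    (hbB : ∀ᶠ n in atTop, ∀ p, |b n p| ≤ B n) :
    TendstoInDistribution (fun n ω => ∑ p, b n p * X (e n p) ω) atTop (id : ℝ → ℝ)
      (fun _ => P) (gaussianReal 0 1) := by
  have hXm i : AEMeasurable (X i) P := (hident i).aemeasurable_fst
  refine ⟨fun n => Finset.aemeasurable_fun_sum _ fun p _ => (hXm _).const_mul _,
    aemeasurable_id, ProbabilityMeasure.tendsto_iff_tendsto_charFun.2 fun t => ?_⟩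
  simp only [ProbabilityMeasure.coe_mk, Measure.map_id]
  have hprod n : charFun (P.map fun ω => ∑ p, b n p * X (e n p) ω) t =
      ∏ p, charFun (P.map (X i₀)) (b n p * t) := by
    have hind : iIndepFun (fun p ω => b n p * X (e n p) ω) P :=
      (hindep.precomp (he n)).comp (fun p x => b n p * x) (fun p => by fun_prop)
    rw [hind.charFun_map_fun_sum_eq_prod fun p => (hXm _).const_mul _, Finset.prod_apply]
    refine Finset.prod_congr rfl fun p _ => ?_
    rw [charFun_map_mul_comp (hXm _), (hident _).map_eq]
  -- Since the weights have square sum 1, the Gaussian characteristic function splits into the same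
  -- number of factors, so the two products can be compared factor by factor.
  have hgauss : ∀ᶠ n in atTop, charFun (gaussianReal 0 1) t =
      ∏ p, charFun (gaussianReal 0 1) (b n p * t) := by
    filter_upwards [hb] with n hn
    simp only [charFun_gaussianReal]
    rw [← Complex.exp_sum]
    congr 1
    have hn' : ∑ p, (b n p : ℂ) ^ 2 = 1 := by exact_mod_cast hn
    calc _ = -((∑ p, (b n p : ℂ) ^ 2) * (t : ℂ) ^ 2 / 2) := by rw [hn']; simp
      _ = _ := by
        rw [Finset.sum_mul, Finset.sum_div, ← Finset.sum_neg_distrib]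
        refine Finset.sum_congr rfl fun p _ => ?_
        push_cast; simp; ring
  rw [Metric.tendsto_atTop']
  intro η hη
  have : IsProbabilityMeasure (P.map (X i₀)) := Measure.isProbabilityMeasure_map (hXm _)
  -- With this constant the factorwise errors add up to at most `η t² / (t² + 1) < η`, including at
  -- `t = 0`.
  have hlo := (charFun_sub_charFun_gaussianReal_isLittleO (hXm i₀) h0 h1).def
    (c := η / (t ^ 2 + 1)) (by positivity)
  obtain ⟨r, hr, hball⟩ := Metric.eventually_nhds_iff.1 hlo
  have hBt : Tendsto (fun n => B n * |t|) atTop (𝓝 0) := by simpa using hB.mul_const |t|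
  obtain ⟨N, hN⟩ := eventually_atTop.1
    (hgauss.and (hb.and (hbB.and (hBt.eventually (gt_mem_nhds hr)))))
  refine ⟨N, fun n hn => ?_⟩
  obtain ⟨hg, hs, hB', hr'⟩ := hN n hn.le
  rw [dist_eq_norm, hprod, hg]
  calc _ ≤ ∑ p, ‖charFun (P.map (X i₀)) (b n p * t) - charFun (gaussianReal 0 1) (b n p * t)‖ :=
        norm_prod_sub_prod_le_sum _ _ _ (fun _ _ => norm_charFun_le_one _)
          (fun _ _ => norm_charFun_le_one _)
    _ ≤ ∑ p, η / (t ^ 2 + 1) * (b n p ^ 2 * t ^ 2) := by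
        refine Finset.sum_le_sum fun p _ => ?_
        have h := @hball (b n p * t) (by
          rw [dist_zero_right, Real.norm_eq_abs, abs_mul]
          exact (mul_le_mul_of_nonneg_right (hB' p) (abs_nonneg t)).trans_lt hr')
        refine h.trans_eq ?_
        rw [norm_pow, Complex.norm_real, Real.norm_eq_abs, sq_abs, mul_pow]
    _ = η * (t ^ 2 / (t ^ 2 + 1)) := by
        rw [← Finset.mul_sum, ← Finset.sum_mul, hs]; ring
    _ < η := by
        refine mul_lt_of_lt_one_right hη ?_
        rw [div_lt_one (by positivity)]; linarith

/-! ### The regression matrix -/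

section Regression

variable {d : ℕ} (ε : ℕ → ℝ) (n : ℕ)

theorem regressionMatrix_mulVec (u : Fin (d + 1) ⊕ Unit → ℝ) (p : Fin n × Fin (d + 1)) :
    (regressionMatrix d ε n *ᵥ u) p = u (Sum.inl p.2) + logRadius ε p.1 * u (Sum.inr ()) := by
  simp [regressionMatrix, Matrix.mulVec, dotProduct]

theorem sum_logRadius_sub_mean (hn : n ≠ 0) :
    ∑ j ∈ Finset.range n, (logRadius ε j - meanLogRadius ε n) = 0 := by
  have : (n : ℝ) ≠ 0 := by exact_mod_cast hn
  rw [Finset.sum_sub_distrib]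
  simp [meanLogRadius]
  field_simp
  ring

theorem sum_sq_logRadius_sub_mean (hn : n ≠ 0) :
    ∑ j ∈ Finset.range n, (logRadius ε j - meanLogRadius ε n) ^ 2 = n * varLogRadius ε n := by
  have : (n : ℝ) ≠ 0 := by exact_mod_cast hn
  rw [varLogRadius]; field_simp

/-- The squared norm of `X u`, in terms of the centered regressors. -/
theorem sum_sq_regressionMatrix_mulVec (hn : n ≠ 0) (u : Fin (d + 1) ⊕ Unit → ℝ) :
    ∑ p, (regressionMatrix d ε n *ᵥ u) p ^ 2 =
      n * ∑ k, (u (Sum.inl k) + meanLogRadius ε n * u (Sum.inr ())) ^ 2 +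
        (d + 1) * (n * varLogRadius ε n) * u (Sum.inr ()) ^ 2 := by
  set v := u (Sum.inr ())
  set m := meanLogRadius ε n
  have key (k : Fin (d + 1)) : ∑ j : Fin n, (u (Sum.inl k) + logRadius ε j * v) ^ 2 =
      n * (u (Sum.inl k) + m * v) ^ 2 + n * varLogRadius ε n * v ^ 2 := by
    rw [Fin.sum_univ_eq_sum_range fun j => (u (Sum.inl k) + logRadius ε j * v) ^ 2]
    -- Expanding around the mean makes the cross term sum to zero.
    calc _ = ∑ j ∈ Finset.range n, ((u (Sum.inl k) + m * v) ^ 2 +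
          2 * (u (Sum.inl k) + m * v) * v * (logRadius ε j - m) +
          (logRadius ε j - m) ^ 2 * v ^ 2) := Finset.sum_congr rfl fun j _ => by ring
      _ = _ := by
        rw [Finset.sum_add_distrib, Finset.sum_add_distrib, ← Finset.mul_sum, ← Finset.sum_mul,
          sum_logRadius_sub_mean ε n hn, sum_sq_logRadius_sub_mean ε n hn]
        simp
  simp only [regressionMatrix_mulVec]
  rw [Fintype.sum_prod_type_right, Finset.sum_congr rfl fun k _ => key k]
  rw [Finset.sum_add_distrib, ← Finset.mul_sum]
  simp
  ring

variable {ε n}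

/-- If `Xu = 0`, both nonnegative parts of `‖Xu‖²` vanish: positive variance kills the slope, and
then the intercepts vanish too. -/
theorem regressionMatrix_mulVec_injective (hn : n ≠ 0) (hS : 0 < varLogRadius ε n) :
    Function.Injective (regressionMatrix d ε n).mulVec := by
  have hn' : (0 : ℝ) < n := by exact_mod_cast Nat.pos_of_ne_zero hn
  refine (injective_iff_map_eq_zero (regressionMatrix d ε n).mulVecLin).2 fun u hu => ?_
  have h := sum_sq_regressionMatrix_mulVec ε n hn u
  rw [Matrix.mulVecLin_apply] at hu
  rw [hu] at h
  have hpos : 0 ≤ ∑ k, (u (Sum.inl k) + meanLogRadius ε n * u (Sum.inr ())) ^ 2 :=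
    Finset.sum_nonneg fun _ _ => sq_nonneg _
  have hpos' : 0 ≤ (n : ℝ) * ∑ k, (u (Sum.inl k) + meanLogRadius ε n * u (Sum.inr ())) ^ 2 := by
    positivity
  have hc : 0 < ((d : ℝ) + 1) * (n * varLogRadius ε n) := by positivity
  have hpos'' := mul_nonneg hc.le (sq_nonneg (u (Sum.inr ())))
  simp only [Pi.zero_apply, ne_eq, OfNat.ofNat_ne_zero, not_false_eq_true, zero_pow,
    Finset.sum_const_zero] at h
  have hv : u (Sum.inr ()) = 0 := by
    have : ((d : ℝ) + 1) * (n * varLogRadius ε n) * u (Sum.inr ()) ^ 2 = 0 := by linarith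
    simpa [hc.ne'] using this
  have hs : ∑ k, (u (Sum.inl k) + meanLogRadius ε n * u (Sum.inr ())) ^ 2 = 0 := by
    have : (n : ℝ) * ∑ k, (u (Sum.inl k) + meanLogRadius ε n * u (Sum.inr ())) ^ 2 = 0 := by
      linarith
    exact (mul_eq_zero.1 this).resolve_left hn'.ne'
  rw [Finset.sum_eq_zero_iff_of_nonneg fun _ _ => sq_nonneg _] at hs
  ext q
  rcases q with k | q
  · simpa [hv] using hs k (Finset.mem_univ k)
  · exact hv

theorem isUnit_gram_det (hn : n ≠ 0) (hS : 0 < varLogRadius ε n) :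
    IsUnit ((regressionMatrix d ε n)ᵀ * regressionMatrix d ε n).det := by
  have h := Matrix.PosDef.conjTranspose_mul_self (regressionMatrix d ε n)
    (regressionMatrix_mulVec_injective hn hS)
  rw [Matrix.conjTranspose_eq_transpose_of_trivial] at h
  exact h.det_pos.ne'.isUnit

/-- The entries of `X u` are small compared with the norm of `X u`. -/
theorem sq_regressionMatrix_mulVec_le (hn : n ≠ 0) (hS : 0 < varLogRadius ε n)
    (u : Fin (d + 1) ⊕ Unit → ℝ) {R : ℝ}
    (hR : ∀ j < n, (logRadius ε j - meanLogRadius ε n) ^ 2 ≤ R) (p : Fin n × Fin (d + 1)) :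
    (regressionMatrix d ε n *ᵥ u) p ^ 2 ≤
      (2 / n + 2 * R / (n * varLogRadius ε n)) * ∑ q, (regressionMatrix d ε n *ᵥ u) q ^ 2 := by
  have hn' : (0 : ℝ) < n := by exact_mod_cast Nat.pos_of_ne_zero hn
  rw [sum_sq_regressionMatrix_mulVec ε n hn, regressionMatrix_mulVec]
  set v := u (Sum.inr ())
  set m := meanLogRadius ε n
  set A := ∑ k, (u (Sum.inl k) + m * v) ^ 2
  have hA : (u (Sum.inl p.2) + m * v) ^ 2 ≤ A :=
    Finset.single_le_sum (f := fun k => (u (Sum.inl k) + m * v) ^ 2)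
      (fun _ _ => sq_nonneg _) (Finset.mem_univ p.2)
  have hA0 : 0 ≤ A := (sq_nonneg _).trans hA
  have hx := hR p.1 p.1.2
  have hR0 : 0 ≤ R := (sq_nonneg _).trans hx
  have hd : (0 : ℝ) ≤ d := Nat.cast_nonneg d
  calc (u (Sum.inl p.2) + logRadius ε p.1 * v) ^ 2
      = ((u (Sum.inl p.2) + m * v) + (logRadius ε p.1 - m) * v) ^ 2 := by ring
    _ ≤ 2 * (u (Sum.inl p.2) + m * v) ^ 2 + 2 * ((logRadius ε p.1 - m) ^ 2 * v ^ 2) := by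
        nlinarith [sq_nonneg ((u (Sum.inl p.2) + m * v) - (logRadius ε p.1 - m) * v)]
    _ ≤ 2 * A + 2 * (R * v ^ 2) := by gcongr
    _ = 2 / n * (n * A) + 2 * R / (n * varLogRadius ε n) * (n * varLogRadius ε n * v ^ 2) := by
        field_simp
    -- Each of the two parts is at most the whole of `‖Xu‖²`.
    _ ≤ 2 / n * (n * A + (d + 1) * (n * varLogRadius ε n) * v ^ 2) +
        2 * R / (n * varLogRadius ε n) * (n * A + (d + 1) * (n * varLogRadius ε n) * v ^ 2) := by
        have h1 : 0 ≤ n * varLogRadius ε n * v ^ 2 := by positivity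
        have h2 : 0 ≤ n * A := by positivity
        gcongr ?_ * ?_ + ?_ * ?_
        · nlinarith
        · nlinarith
    _ = _ := by ring

/-- Substituting `y = Xβ + δ` leaves the error `G⁻¹Xᵀδ`; the symmetry of `G⁻¹` moves it onto `t`. -/
theorem dotProduct_leastSquares_sub (hM : IsUnit
      ((regressionMatrix d ε n)ᵀ * regressionMatrix d ε n).det)
    (β t : Fin (d + 1) ⊕ Unit → ℝ) (y δ : ℕ → Fin (d + 1) → ℝ)
    (hy : ∀ j k, y j k = β (Sum.inl k) + logRadius ε j * β (Sum.inr ()) + δ j k) :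
    t ⬝ᵥ (leastSquares ε n y - β) = ∑ p : Fin n × Fin (d + 1),
      (regressionMatrix d ε n *ᵥ
        (((regressionMatrix d ε n)ᵀ * regressionMatrix d ε n)⁻¹ *ᵥ t)) p * δ p.1 p.2 := by
  set X := regressionMatrix d ε n with hX
  have hyv : (fun p : Fin n × Fin (d + 1) => y p.1 p.2) =
      X *ᵥ β + fun p : Fin n × Fin (d + 1) => δ p.1 p.2 := by
    ext p
    rw [Pi.add_apply, hX, regressionMatrix_mulVec, hy]
  have hls : leastSquares ε n y - β =
      (Xᵀ * X)⁻¹ *ᵥ (Xᵀ *ᵥ fun p : Fin n × Fin (d + 1) => δ p.1 p.2) := by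
    rw [leastSquares, ← hX, hyv, Matrix.mulVec_add, Matrix.mulVec_add, Matrix.mulVec_mulVec,
      Matrix.mulVec_mulVec, Matrix.mul_assoc, Matrix.nonsing_inv_mul _ hM, Matrix.one_mulVec, add_sub_cancel_left]
  have hsymm : ((Xᵀ * X)⁻¹)ᵀ = (Xᵀ * X)⁻¹ := by
    rw [Matrix.transpose_nonsing_inv, Matrix.transpose_mul, Matrix.transpose_transpose]
  rw [hls, Matrix.dotProduct_mulVec, ← Matrix.mulVec_transpose, hsymm, Matrix.dotProduct_mulVec,
    Matrix.vecMul_transpose]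
  rfl

/-- For `u = G⁻¹t` one has `t = XᵀXu`, hence `t·u = ‖Xu‖²`. -/
theorem dotProduct_gram_inv_mulVec (hM : IsUnit
      ((regressionMatrix d ε n)ᵀ * regressionMatrix d ε n).det)
    (t : Fin (d + 1) ⊕ Unit → ℝ) :
    t ⬝ᵥ (((regressionMatrix d ε n)ᵀ * regressionMatrix d ε n)⁻¹ *ᵥ t) =
      ∑ p, (regressionMatrix d ε n *ᵥ
        (((regressionMatrix d ε n)ᵀ * regressionMatrix d ε n)⁻¹ *ᵥ t)) p ^ 2 := by
  set X := regressionMatrix d ε n with hX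
  set u := (Xᵀ * X)⁻¹ *ᵥ t with hu
  have ht : t = Xᵀ *ᵥ (X *ᵥ u) := by
    rw [hu, Matrix.mulVec_mulVec, Matrix.mulVec_mulVec, Matrix.mul_nonsing_inv _ hM,
      Matrix.one_mulVec]
  calc t ⬝ᵥ u = (Xᵀ *ᵥ (X *ᵥ u)) ⬝ᵥ u := by rw [← ht]
    _ = (X *ᵥ u) ⬝ᵥ (X *ᵥ u) := by rw [Matrix.mulVec_transpose, ← Matrix.dotProduct_mulVec]
    _ = _ := by simp [dotProduct, pow_two]

end Regression

/-- Allows discarding the finitely many `n` for which the Gram matrix may be singular. -/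
theorem MeasureTheory.TendstoInDistribution.congr_eventually {Ω Ω' E : Type*} [MeasurableSpace Ω]
    [MeasurableSpace Ω'] [MeasurableSpace E] [TopologicalSpace E] [OpensMeasurableSpace E]
    {P : Measure Ω} [IsProbabilityMeasure P] {P' : Measure Ω'} [IsProbabilityMeasure P']
    {X Y : ℕ → Ω → E} {Z : Ω' → E}
    (h : TendstoInDistribution X atTop Z (fun _ => P) P') (hY : ∀ n, AEMeasurable (Y n) P)
    (hXY : ∀ᶠ n in atTop, X n = Y n) :
    TendstoInDistribution Y atTop Z (fun _ => P) P' := by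
  refine ⟨hY, h.aemeasurable_limit, h.tendsto.congr' ?_⟩
  filter_upwards [hXY] with n hn
  exact Subtype.ext (congrArg (Measure.map · P) hn)

/-! ### Growth of the regressors -/

/-- The comparison function never vanishes, so the asymptotic bound holds for every index with one
constant. Indices start at 0, so `j < n` gives `j + 1 ≤ n`, and the power is monotone. -/
theorem exists_abs_logRadius_le {ε : ℕ → ℝ} {μ : ℝ} (hμ : 0 ≤ μ)
    (hx : (fun n : ℕ => logRadius ε n) =O[atTop] fun n : ℕ => ((n : ℝ) + 1) ^ (μ / 2)) :
    ∃ C, 0 ≤ C ∧ ∀ n j, j < n → |logRadius ε j| ≤ C * (n : ℝ) ^ (μ / 2) := by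
  rw [isBigO_nat_atTop_iff fun n h => absurd h (by positivity)] at hx
  obtain ⟨C, hC⟩ := hx
  refine ⟨|C|, abs_nonneg C, fun n j hj => (hC j).trans ?_⟩
  have hj' : (j : ℝ) + 1 ≤ n := by exact_mod_cast hj
  rw [Real.norm_of_nonneg (by positivity)]
  gcongr
  exact le_abs_self C

theorem sq_logRadius_sub_mean_le {ε : ℕ → ℝ} {n : ℕ} {K : ℝ}
    (hK : ∀ j < n, |logRadius ε j| ≤ K) (j : ℕ) (hj : j < n) :
    (logRadius ε j - meanLogRadius ε n) ^ 2 ≤ (2 * K) ^ 2 := by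
  have hn : (0 : ℝ) < n := by exact_mod_cast (Nat.zero_le j).trans_lt hj
  have hm : |meanLogRadius ε n| ≤ K := by
    rw [meanLogRadius, abs_div, abs_of_pos hn, div_le_iff₀ hn]
    calc _ ≤ ∑ i ∈ Finset.range n, |logRadius ε i| := Finset.abs_sum_le_sum_abs _ _
      _ ≤ ∑ i ∈ Finset.range n, K :=
        Finset.sum_le_sum fun i hi => hK i (Finset.mem_range.1 hi)
      _ = K * n := by simp [mul_comm]
  refine sq_le_sq.2 (((abs_sub _ _).trans (add_le_add (hK j hj) hm)).trans ?_)
  rw [← two_mul]; exact le_abs_self _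

theorem exists_regressionMatrix_entry_bound {d : ℕ} {ε : ℕ → ℝ} {γ μ : ℝ} (hγ : 0 ≤ γ)
    (hμ : 0 ≤ μ) (hμ1 : μ < 1)
    (hS : (fun n : ℕ => varLogRadius ε n) =Θ[atTop] fun n : ℕ => (n : ℝ) ^ γ)
    (hx : (fun n : ℕ => logRadius ε n) =O[atTop] fun n : ℕ => ((n : ℝ) + 1) ^ (μ / 2)) :
    ∃ B : ℕ → ℝ, Tendsto B atTop (𝓝 0) ∧ ∀ᶠ n in atTop, n ≠ 0 ∧ 0 < varLogRadius ε n ∧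
      ∀ (u : Fin (d + 1) ⊕ Unit → ℝ) (p : Fin n × Fin (d + 1)),
        (regressionMatrix d ε n *ᵥ u) p ^ 2 ≤
          B n * ∑ q, (regressionMatrix d ε n *ᵥ u) q ^ 2 := by
  obtain ⟨C, -, hC⟩ := exists_abs_logRadius_le hμ hx
  obtain ⟨c, hc, hcS⟩ := hS.2.exists_pos
  -- Take `R = (2 C n^(μ/2))²`, so that `2R = 8 C² n^μ`; the factor `c` comes from `1 ≤ n^γ ≤ c
  -- S̃_n²`.
  refine ⟨fun n => 2 / n + 8 * C ^ 2 * c * (n : ℝ) ^ (-(1 - μ)), ?_, ?_⟩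
  · have h1 := tendsto_const_div_atTop_nhds_zero_nat (2 : ℝ)
    have h2 := ((tendsto_rpow_neg_atTop (sub_pos.2 hμ1)).comp
      tendsto_natCast_atTop_atTop).const_mul (8 * C ^ 2 * c)
    simpa using h1.add h2
  · filter_upwards [hcS.bound, eventually_gt_atTop 0] with n hn hn0
    have hn' : (0 : ℝ) < n := by exact_mod_cast hn0
    have hn1 : (1 : ℝ) ≤ n := by exact_mod_cast hn0
    have hpow : 1 ≤ (n : ℝ) ^ γ := Real.one_le_rpow hn1 hγ
    have hS0 : 0 ≤ varLogRadius ε n :=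
      div_nonneg (Finset.sum_nonneg fun _ _ => sq_nonneg _) hn'.le
    rw [Real.norm_of_nonneg (by positivity), Real.norm_of_nonneg hS0] at hn
    have hcS1 : 1 ≤ c * varLogRadius ε n := hpow.trans hn
    have hSpos : 0 < varLogRadius ε n := pos_of_mul_pos_right (zero_lt_one.trans_le hcS1) hc.le
    refine ⟨hn0.ne', hSpos, fun u p => ?_⟩
    refine (sq_regressionMatrix_mulVec_le hn0.ne' hSpos u
      (sq_logRadius_sub_mean_le (hC n)) p).trans ?_
    refine mul_le_mul_of_nonneg_right ?_ (Finset.sum_nonneg fun _ _ => sq_nonneg _)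
    gcongr
    have hsq : ((n : ℝ) ^ (μ / 2)) ^ 2 = (n : ℝ) ^ μ := by
      rw [← Real.rpow_natCast, ← Real.rpow_mul hn'.le]; norm_num
    have hsub : (n : ℝ) ^ (-(1 - μ)) = (n : ℝ) ^ μ / n := by
      rw [neg_sub, Real.rpow_sub_one hn'.ne']
    rw [hsub, mul_pow, mul_pow, hsq, div_le_iff₀ (by positivity)]
    have h0 : 0 ≤ 8 * C ^ 2 * (n : ℝ) ^ μ := by positivity
    calc 2 * (2 ^ 2 * (C ^ 2 * (n : ℝ) ^ μ)) = 8 * C ^ 2 * (n : ℝ) ^ μ * 1 := by ring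
      _ ≤ 8 * C ^ 2 * (n : ℝ) ^ μ * (c * varLogRadius ε n) := by gcongr
      _ = _ := by field_simp


/-! ### Asymptotic normality of the least-squares estimator -/

theorem mainTheorem7 {d : ℕ} (F : Set (EuclideanSpace ℝ (Fin d)))
    (hF : Bornology.IsBounded F)
    (hA1 : CurvaturesDefined F)
    (hA2 : CurvaturesOfConstantSign F)
    (s : ℝ) (hs : HasMinkowskiDimension F s)
    (c : Fin (d + 1) → ℝ) (hA3 : ∀ k, HasFractalCurvature F s k (c k)) (hc : ∀ k, c k ≠ 0)
    -- the decreasing radii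
    (ε : ℕ → ℝ) (hεpos : ∀ j, 0 < ε j) (hεanti : StrictAnti ε)
    (γ μ : ℝ) (hγ : 0 ≤ γ) (hμ : 0 ≤ μ) (hγμ : max μ (2 * μ - γ) < 1)
    (hS : (fun n : ℕ => varLogRadius ε n) =Θ[atTop] fun n : ℕ => (n : ℝ) ^ γ)
    (hx : (fun n : ℕ => logRadius ε n) =O[atTop] fun n : ℕ => ((n : ℝ) + 1) ^ (μ / 2))
    -- the errors
    {Ω : Type*} [MeasurableSpace Ω] (P : Measure Ω) [IsProbabilityMeasure P]
    (δ : ℕ → Fin (d + 1) → Ω → ℝ)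
    (hδL2 : ∀ j k, MemLp (δ j k) 2 P)
    (hδmean : ∀ j k, ∫ ω, δ j k ω ∂P = 0)
    (hδindep : iIndepFun (fun p : ℕ × Fin (d + 1) => δ p.1 p.2) P)
    (hδident : ∀ j k j' k', IdentDistrib (δ j k) (δ j' k') P P)
    (σ : ℝ) (hσ : 0 < σ) (hQ : ∀ n, errorCovariance P δ n = σ ^ 2 • 1)
    -- the parameters and the observations
    (β : Fin (d + 1) ⊕ Unit → ℝ)
    (hβ : β = Sum.elim (fun k => Real.log |c k|) (fun _ => s))
    (y : ℕ → Fin (d + 1) → Ω → ℝ)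
    (hy : ∀ j k ω, y j k ω = β (Sum.inl k) + logRadius ε j * β (Sum.inr ()) + δ j k ω)
    (t : Fin (d + 1) ⊕ Unit → ℝ) (ht : t ≠ 0) :
    TendstoInDistribution
      (fun (n : ℕ) (ω : Ω) =>
        (t ⬝ᵥ (leastSquares ε n (fun j k => y j k ω) - β)) /
          (σ * √(t ⬝ᵥ (((regressionMatrix d ε n)ᵀ * regressionMatrix d ε n)⁻¹ *ᵥ t))))
      atTop (id : ℝ → ℝ) (fun _ => P) (gaussianReal 0 1) := by
  obtain ⟨B, hB, hBn⟩ := exists_regressionMatrix_entry_bound (d := d) hγ hμ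
    ((le_max_left _ _).trans_lt hγμ) hS hx
  set a : ∀ n, Fin n × Fin (d + 1) → ℝ := fun n => regressionMatrix d ε n *ᵥ
    (((regressionMatrix d ε n)ᵀ * regressionMatrix d ε n)⁻¹ *ᵥ t)
  have hδm j k : AEMeasurable (δ j k) P := (hδident j k j k).aemeasurable_fst
  -- If `a = 0`, injectivity of `X` gives `G⁻¹t = 0`, so `t = G G⁻¹t = 0`.
  have ha : ∀ᶠ n in atTop, 0 < ∑ p, a n p ^ 2 := by
    filter_upwards [hBn] with n hn
    refine (Finset.sum_nonneg fun _ _ => sq_nonneg _).lt_of_ne' fun h0 => ht ?_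
    have hM := isUnit_gram_det (d := d) hn.1 hn.2.1
    have hzero : a n = 0 := by
      rw [Finset.sum_eq_zero_iff_of_nonneg fun _ _ => sq_nonneg _] at h0
      ext p
      simpa using h0 p (Finset.mem_univ p)
    have hu := regressionMatrix_mulVec_injective hn.1 hn.2.1
      (hzero.trans (Matrix.mulVec_zero _).symm)
    rw [← Matrix.one_mulVec t, ← Matrix.mul_nonsing_inv _ hM, ← Matrix.mulVec_mulVec, hu,
      Matrix.mulVec_zero]
  have hmom : ∫ ω, δ 0 0 ω * δ 0 0 ω ∂P = σ ^ 2 := by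
    simpa [errorCovariance] using congrFun (congrFun (hQ 1) (0, 0)) (0, 0)
  have hclt := tendstoInDistribution_weighted_sum (P := P)
    (X := fun (p : ℕ × Fin (d + 1)) ω => δ p.1 p.2 ω / σ)
    (hδindep.comp (fun _ x => x / σ) fun _ => by fun_prop) (0, 0)
    (fun p => (hδident p.1 p.2 0 0).comp (u := fun x => x / σ) (by fun_prop))
    (by simp [integral_div, hδmean])
    (by
      simp only [Pi.pow_apply, div_pow, pow_two (δ 0 0 _)]
      rw [integral_div, hmom, div_self (by positivity)])
    (κ := fun n => Fin n × Fin (d + 1)) (e := fun n p => (p.1, p.2))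
    (fun n p q h => by
      simp only [Prod.mk.injEq] at h
      exact Prod.ext (Fin.ext h.1) h.2)
    (fun n p => a n p / √(∑ q, a n q ^ 2))
    (by
      filter_upwards [ha] with n hn
      simp only [div_pow]
      rw [← Finset.sum_div, Real.sq_sqrt hn.le, div_self hn.ne'])
    -- The entry bound controls squares of weights, hence the square root.
    (B := fun n => √(B n))
    (by simpa [Function.comp_def] using (Real.continuous_sqrt.tendsto 0).comp hB)
    (by
      filter_upwards [ha, hBn] with n hn hn' p
      refine Real.abs_le_sqrt ?_
      rw [div_pow, Real.sq_sqrt hn.le, div_le_iff₀ hn]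
      exact hn'.2.2 _ p)
  refine hclt.congr_eventually (fun n => ?_) ?_
  · have hym j k : AEMeasurable (y j k) P := by
      rw [funext (hy j k)]
      exact (hδm j k).const_add _
    simp only [leastSquares, Matrix.mulVec, dotProduct, Pi.sub_apply]
    fun_prop
  · filter_upwards [hBn] with n hn
    have hM := isUnit_gram_det (d := d) hn.1 hn.2.1
    ext ω
    rw [dotProduct_leastSquares_sub hM β t (fun j k => y j k ω) (fun j k => δ j k ω)
      (fun j k => hy j k ω), dotProduct_gram_inv_mulVec hM, Finset.sum_div]
    refine Finset.sum_congr rfl fun p _ => ?_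
    rw [div_mul_div_comm, mul_comm σ]
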